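/- Let $\mathcal{E}$ be a category with small products and small filtered colimits. Let $\mathbf{Fam}(\mathcal{E})$ be the category whose objects are families $(S_x)_{x\in X}$ of objects of $\mathcal{E}$ indexed by a (small) set $X$, and in which a map $(S_x)_{x\in X}\to(R_y)_{y\in Y}$ is a function $f\colon X\to Y$ together with a map $\phi_x\colon R_{f(x)}\to S_x$ in $\mathcal{E}$ for each $x\in X$. Let $\mathbf{FinFam}(\mathcal{E})$ be the full subcategory of the families whose indexing set is finite. A functor $G\colon\mathcal{B}\to\mathcal{A}$ has a codensity monad if for each $A\in\mathcal{A}$ the limit $T^G(A)=\lim_{B\in\mathcal{B},\,f\colon A\to G(B)}G(B)$, taken over the comma category $A/G$, exists. Then $T^G$, with its canonical transformation $\kappa\colon T^G G\to G$, is the right Kan extension of $G$ along itself, and the codensity monad of $G$ is $T^G$ with the unit $\eta$ and multiplication $\mu$ determined by $\kappa\circ\eta G=\mathrm{id}_G$ and $\kappa\circ\mu G=\kappa\circ T^G\kappa$. For a family $S=(S_x)_{x\in X}$ and an ultrafilter $\mathcal{U}$ on $X$, the ultraproduct $\prod_{\mathcal{U}}S$ is the colimit of $H\mapsto\prod_{x\in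 H}S_x$ over $H\in(\mathcal{U},\subseteq)^{\mathrm{op}}$, where inclusions act by projection. Write $U(X)$ for the set of ultrafilters on $X$. The ultraproduct monad $\mathbb{V}$ on $\mathbf{Fam}(\mathcal{E})$ is the following. - On objects, $V\bigl((S_x)_{x\in X}\bigr)=\bigl(\prod_{\mathcal{U}}S\bigr)_{\mathcal{U}\in U(X)}$. - A map $(f,\phi)\colon(S_x)_{x\in X}\to(R_y)_{y\in Y}$ is sent to the function $\mathcal{U}\mapsto f_*\mathcal{U}$ together with the maps $\prod_{f_*\mathcal{U}}R\to\prod_{\mathcal{U}}S$ whose component at $K\in f_*\mathcal{U}$ is the map $\prod_{y\in K}R_y\to\prod_{x\in f^{-1}K}S_x$ induced by the $\phi_x$, followed by the coprojection. - The unit consists of the function sending $x$ to the principal ultrafilter $\mathcal{U}_x$ on $x$, and the canonical isomorphisms $\prod_{\mathcal{U}_x}S\to S_x$. - The multiplication consists of the function $U(U(X))\to U(X)$ sending $\mathcal{W}$ to $\bar{\mathcal{W}}=\{H\subseteq X:\{\mathcal{U}:H\in\mathcal{U}\}\in\mathcal{W}\}$, and the maps $\prod_{\bar{\mathcal{W}}}S\to\prod_{\mathcal{W}}\bigl(\prod_{\mathcal{U}}S\bigr)_{\mathcal{U}\in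 U(X)}$ whose component at $H\in\bar{\mathcal{W}}$ is the map $\prod_{x\in H}S_x\to\prod_{\mathcal{U}\ni H}\prod_{\mathcal{U}}S$ given by the coprojections, followed by the coprojection at $\{\mathcal{U}:H\in\mathcal{U}\}$. **Theorem.** The inclusion functor $\mathbf{FinFam}(\mathcal{E})\hookrightarrow\mathbf{Fam}(\mathcal{E})$ has a codensity monad, and this codensity monad is isomorphic, as a monad, to the ultraproduct monad $\mathbb{V}$ on $\mathbf{Fam}(\mathcal{E})$. -/

import Mathlib

open CategoryTheory CategoryTheory.Limits Opposite

universe w v u v₁ v₂ u₁ u₂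

/-! ### Codensity monads -/

section Codensity

variable {B : Type u₁} [Category.{v₁} B] {A : Type u₂} [Category.{v₂} A]

/-- A functor `G : B ⥤ A` has a codensity monad if, for each `a : A`, the limit of `G b` over
all pairs `(b : B, f : a ⟶ G b)`, i.e. over the comma category `a / G`, exists. -/
abbrev HasCodensityMonad (G : B ⥤ A) : Prop := G.HasPointwiseRightKanExtension G

variable (G : B ⥤ A) [HasCodensityMonad G]

/-- The underlying endofunctor of the codensity monad: the right Kan extension of `G` along
itself, given by `a ↦ lim_{(b, f : a ⟶ G b)} G b`. -/
noncomputable def codensityFunctor : A ⥤ A := G.pointwiseRightKanExtension G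

/-- The canonical natural transformation of the right Kan extension. -/
noncomputable def codensityCounit : G ⋙ codensityFunctor G ⟶ G :=
  G.pointwiseRightKanExtensionCounit G

instance codensityFunctor_isRightKanExtension :
    (codensityFunctor G).IsRightKanExtension (codensityCounit G) :=
  inferInstanceAs ((G.pointwiseRightKanExtension G).IsRightKanExtension
    (G.pointwiseRightKanExtensionCounit G))

/-- The unit: the unique natural transformation `𝟭 A ⟶ T` whose composite with the counit is the
identity of `G`. -/
noncomputable def codensityUnit : 𝟭 A ⟶ codensityFunctor G :=
  (codensityFunctor G).liftOfIsRightKanExtension (codensityCounit G) (𝟭 A) (𝟙 G)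

/-- The multiplication: the unique natural transformation `T ⋙ T ⟶ T` whose composite with the
counit `κ` is `κ ∘ T κ`. -/
noncomputable def codensityMul :
    codensityFunctor G ⋙ codensityFunctor G ⟶ codensityFunctor G :=
  (codensityFunctor G).liftOfIsRightKanExtension (codensityCounit G)
    (codensityFunctor G ⋙ codensityFunctor G)
    (Functor.whiskerRight (codensityCounit G) (codensityFunctor G) ≫ codensityCounit G)

theorem codensityUnit_fac (b : B) :
    (codensityUnit G).app (G.obj b) ≫ (codensityCounit G).app b = 𝟙 (G.obj b) :=
  (codensityFunctor G).liftOfIsRightKanExtension_fac_app (codensityCounit G) (𝟭 A) (𝟙 G) b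

theorem codensityMul_fac (b : B) :
    (codensityMul G).app (G.obj b) ≫ (codensityCounit G).app b =
      (codensityFunctor G).map ((codensityCounit G).app b) ≫ (codensityCounit G).app b :=
  (codensityFunctor G).liftOfIsRightKanExtension_fac_app (codensityCounit G)
    (codensityFunctor G ⋙ codensityFunctor G)
    (Functor.whiskerRight (codensityCounit G) (codensityFunctor G) ≫ codensityCounit G) b

theorem codensity_hom_ext {F : A ⥤ A} (α β : F ⟶ codensityFunctor G)
    (h : ∀ b, α.app (G.obj b) ≫ (codensityCounit G).app b =
      β.app (G.obj b) ≫ (codensityCounit G).app b) : α = β :=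
  (codensityFunctor G).hom_ext_of_isRightKanExtension (codensityCounit G) α β
    (by ext b; exact h b)

/-- The codensity monad of `G`: the right Kan extension of `G` along itself, with the monad
structure induced by its universal property. -/
noncomputable def codensityMonad : CategoryTheory.Monad A where
  toFunctor := codensityFunctor G
  η := codensityUnit G
  μ := codensityMul G
  assoc a := by
    have h : Functor.whiskerRight (codensityMul G) (codensityFunctor G) ≫ codensityMul G =
        (Functor.associator _ _ _).hom ≫
          Functor.whiskerLeft (codensityFunctor G) (codensityMul G) ≫ codensityMul G := by
      apply codensity_hom_ext
      intro b
      have n := (codensityMul G).naturality ((codensityCounit G).app b)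
      simp only [Functor.comp_map] at n
      simp only [NatTrans.comp_app, Functor.whiskerRight_app, Functor.whiskerLeft_app,
        Functor.associator_hom_app, Category.assoc, Category.id_comp, codensityMul_fac]
      erw [← reassoc_of% n, codensityMul_fac, ← Functor.map_comp_assoc, codensityMul_fac]
      simp
    have := congrArg (fun t => t.app a) h
    simpa using this
  left_unit a := by
    have h : Functor.whiskerLeft (codensityFunctor G) (codensityUnit G) ≫ codensityMul G =
        (Functor.rightUnitor _).hom := by
      apply codensity_hom_ext
      intro b
      have n := (codensityUnit G).naturality ((codensityCounit G).app b)
      simp only [Functor.id_map] at n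
      simp only [NatTrans.comp_app, Functor.whiskerLeft_app, Category.assoc, codensityMul_fac]
      erw [← reassoc_of% n, codensityUnit_fac]
      simp
    have := congrArg (fun t => t.app a) h
    simpa using this
  right_unit a := by
    have h : Functor.whiskerRight (codensityUnit G) (codensityFunctor G) ≫ codensityMul G =
        (Functor.leftUnitor _).hom := by
      apply codensity_hom_ext
      intro b
      simp only [NatTrans.comp_app, Functor.whiskerRight_app, Category.assoc, codensityMul_fac]
      erw [← Functor.map_comp_assoc, codensityUnit_fac]
      simp
    have := congrArg (fun t => t.app a) h
    simpa using this

end Codensity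

/-! ### Families of objects -/

/-- A family of objects of `E` indexed by a (small) set. -/
structure Fam (E : Type u) where
  /-- the indexing set -/
  Idx : Type w
  /-- the members of the family -/
  obj : Idx → E

namespace Fam

variable {E : Type u} [Category.{v} E]

/-- A map `(S_x)_{x ∈ X} ⟶ (R_y)_{y ∈ Y}` is a function `f : X → Y` together with maps
`R_{f x} ⟶ S_x` for `x ∈ X`. -/
structure Hom (S R : Fam.{w} E) where
  /-- the function between the indexing sets -/
  base : S.Idx → R.Idx
  /-- the maps between the members -/
  map : ∀ x : S.Idx, R.obj (base x) ⟶ S.obj x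

instance : Category (Fam.{w} E) where
  Hom := Hom
  id S := ⟨fun x => x, fun x => 𝟙 (S.obj x)⟩
  comp f g := ⟨fun x => g.base (f.base x), fun x => g.map (f.base x) ≫ f.map x⟩
  id_comp f := by cases f; simp
  comp_id f := by cases f; simp
  assoc f g h := by cases f; cases g; cases h; simp

@[simp] theorem id_base (S : Fam.{w} E) (x : S.Idx) : Hom.base (𝟙 S) x = x := rfl

@[simp] theorem id_map (S : Fam.{w} E) (x : S.Idx) : Hom.map (𝟙 S) x = 𝟙 (S.obj x) := rfl

@[simp] theorem comp_base {S R Q : Fam.{w} E} (f : S ⟶ R) (g : R ⟶ Q) (x : S.Idx) :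
    Hom.base (f ≫ g) x = Hom.base g (Hom.base f x) := rfl

@[simp] theorem comp_map {S R Q : Fam.{w} E} (f : S ⟶ R) (g : R ⟶ Q) (x : S.Idx) :
    Hom.map (f ≫ g) x = Hom.map g (Hom.base f x) ≫ Hom.map f x := rfl

theorem hom_ext {S R : Fam.{w} E} (f g : S ⟶ R) (h : ∀ x, Hom.base f x = Hom.base g x)
    (h' : ∀ x, Hom.map f x = eqToHom (congrArg R.obj (h x)) ≫ Hom.map g x) : f = g := by
  obtain ⟨f, φ⟩ := f
  obtain ⟨g, ψ⟩ := g
  obtain rfl : f = g := funext h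
  obtain rfl : φ = ψ := funext fun x => by simpa using h' x
  rfl

end Fam

/-- A family is finite if its indexing set is finite. -/
def isFiniteFam (E : Type u) [Category.{v} E] : ObjectProperty (Fam.{w} E) :=
  fun S => Finite S.Idx

/-- The full subcategory of `Fam E` on the finite families. -/
abbrev FinFam (E : Type u) [Category.{v} E] := (isFiniteFam.{w} E).FullSubcategory

/-- The inclusion functor of the finite families into all families. -/
abbrev finFamInclusion (E : Type u) [Category.{v} E] : FinFam.{w} E ⥤ Fam.{w} E :=
  (isFiniteFam.{w} E).ι

/-! ### Ultraproducts -/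

section Ultraproduct

variable {E : Type u} [Category.{v} E] [HasProducts.{w} E]

/-- The product `∏_{x ∈ H} S_x`. -/
noncomputable abbrev prodOn {X : Type w} (S : X → E) (H : Set X) : E := ∏ᶜ fun x : H => S x

/-- The projection `∏_{x ∈ K} S_x ⟶ ∏_{x ∈ H} S_x` for `H ⊆ K`. -/
noncomputable def prodRestrict {X : Type w} (S : X → E) {H K : Set X} (h : H ⊆ K) :
    prodOn S K ⟶ prodOn S H :=
  Pi.lift fun x : H => Pi.π (fun x : K => S x) ⟨x.1, h x.2⟩

theorem prodRestrict_π {X : Type w} (S : X → E) {H K : Set X} (h : H ⊆ K) (x : X) (hx : x ∈ H) :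
    prodRestrict S h ≫ Pi.π (fun x : H => S x) ⟨x, hx⟩ =
      Pi.π (fun x : K => S x) ⟨x, h hx⟩ := by
  simp [prodRestrict]

theorem prodOn_hom_ext {X : Type w} {S : X → E} {H : Set X} {Z : E} {f g : Z ⟶ prodOn S H}
    (h : ∀ (x : X) (hx : x ∈ H), f ≫ Pi.π (fun x : H => S x) ⟨x, hx⟩ =
      g ≫ Pi.π (fun x : H => S x) ⟨x, hx⟩) : f = g :=
  Pi.hom_ext _ _ fun x => h x.1 x.2

/-- The map `∏_{y ∈ K} R_y ⟶ ∏_{x ∈ f⁻¹ K} S_x` induced by a map of families `(f, φ)`: its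
`x`-component is the projection to `R_{f x}` followed by `φ_x`. -/
noncomputable def prodMap {S R : Fam.{w} E} (f : S ⟶ R) (K : Set R.Idx) :
    prodOn R.obj K ⟶ prodOn S.obj (Fam.Hom.base f ⁻¹' K) :=
  Pi.lift fun x : (Fam.Hom.base f ⁻¹' K : Set S.Idx) =>
    Pi.π (fun y : K => R.obj y) ⟨Fam.Hom.base f x.1, x.2⟩ ≫ Fam.Hom.map f x.1

theorem prodMap_π {S R : Fam.{w} E} (f : S ⟶ R) (K : Set R.Idx) (x : S.Idx)
    (hx : Fam.Hom.base f x ∈ K) :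
    prodMap f K ≫ Pi.π (fun x : (Fam.Hom.base f ⁻¹' K : Set S.Idx) => S.obj x) ⟨x, hx⟩ =
      Pi.π (fun y : K => R.obj y) ⟨Fam.Hom.base f x, hx⟩ ≫ Fam.Hom.map f x := by
  simp [prodMap]

/-- The functor `(𝒰, ⊆)ᵒᵖ ⥤ E` sending `H` to `∏_{x ∈ H} S_x`, and inclusions to projections. -/
noncomputable def ultraDiagram {X : Type w} (U : Ultrafilter X) (S : X → E) :
    {H : Set X // H ∈ U}ᵒᵖ ⥤ E where
  obj H := prodOn S H.unop.1
  map i := prodRestrict S (leOfHom i.unop)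
  map_id H := by apply Pi.hom_ext; intro x; simp [prodRestrict]
  map_comp i j := by apply Pi.hom_ext; intro x; simp [prodRestrict]

instance ultra_isFiltered {X : Type w} (U : Ultrafilter X) :
    IsFiltered {H : Set X // H ∈ U}ᵒᵖ := by
  have : Nonempty {H : Set X // H ∈ U} := ⟨⟨Set.univ, Filter.univ_mem⟩⟩
  have : IsCodirectedOrder {H : Set X // H ∈ U} :=
    ⟨fun H K => ⟨⟨H.1 ∩ K.1, Filter.inter_mem H.2 K.2⟩, Set.inter_subset_left,
      Set.inter_subset_right⟩⟩
  infer_instance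

variable [HasFilteredColimitsOfSize.{w, w} E]

instance ultra_hasColimitsOfShape {X : Type w} (U : Ultrafilter X) :
    HasColimitsOfShape {H : Set X // H ∈ U}ᵒᵖ E :=
  HasFilteredColimitsOfSize.HasColimitsOfShape _

/-- The ultraproduct of the family `S` with respect to `𝒰`: the colimit of `∏_{x ∈ H} S_x`
over `H ∈ (𝒰, ⊆)ᵒᵖ`. -/
noncomputable def ultraproduct {X : Type w} (U : Ultrafilter X) (S : X → E) : E :=
  colimit (ultraDiagram U S)

namespace ultraproduct

variable {X : Type w}

/-- The coprojection `∏_{x ∈ H} S_x ⟶ ∏_𝒰 S` for `H ∈ 𝒰`. -/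
noncomputable def copr (U : Ultrafilter X) (S : X → E) (H : Set X) (hH : H ∈ U) :
    prodOn S H ⟶ ultraproduct U S :=
  colimit.ι (ultraDiagram U S) (op ⟨H, hH⟩)

theorem restrict_copr (U : Ultrafilter X) (S : X → E) {H K : Set X} (h : H ⊆ K) (hH : H ∈ U)
    (hK : K ∈ U) : prodRestrict S h ≫ copr U S H hH = copr U S K hK :=
  colimit.w (ultraDiagram U S)
    (show op (⟨K, hK⟩ : {H : Set X // H ∈ U}) ⟶ op ⟨H, hH⟩ from (homOfLE h).op)

/-- The map out of an ultraproduct induced by a compatible family of maps. -/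
noncomputable def desc (U : Ultrafilter X) (S : X → E) {Z : E}
    (t : ∀ H : Set X, H ∈ U → (prodOn S H ⟶ Z))
    (ht : ∀ (H K : Set X) (hH : H ∈ U) (hK : K ∈ U) (h : H ⊆ K),
      prodRestrict S h ≫ t H hH = t K hK) : ultraproduct U S ⟶ Z :=
  colimit.desc (ultraDiagram U S)
    { pt := Z
      ι :=
        { app := fun H => t H.unop.1 H.unop.2
          naturality := fun K H i => by
            refine Eq.trans ?_ (Category.comp_id _).symm
            exact ht H.unop.1 K.unop.1 H.unop.2 K.unop.2 (leOfHom i.unop) } }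

@[simp] theorem copr_desc (U : Ultrafilter X) (S : X → E) {Z : E}
    (t : ∀ H : Set X, H ∈ U → (prodOn S H ⟶ Z))
    (ht : ∀ (H K : Set X) (hH : H ∈ U) (hK : K ∈ U) (h : H ⊆ K),
      prodRestrict S h ≫ t H hH = t K hK) (H : Set X) (hH : H ∈ U) :
    copr U S H hH ≫ desc U S t ht = t H hH :=
  colimit.ι_desc _ _

theorem hom_ext {U : Ultrafilter X} {S : X → E} {Z : E} {f g : ultraproduct U S ⟶ Z}
    (h : ∀ (H : Set X) (hH : H ∈ U), copr U S H hH ≫ f = copr U S H hH ≫ g) : f = g :=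
  colimit.hom_ext fun H => h H.unop.1 H.unop.2

end ultraproduct

/-! ### The ultraproduct monad -/

open ultraproduct

/-- The family of all ultraproducts `(∏_𝒰 S)_{𝒰 ∈ U(X)}` of a family `(S_x)_{x ∈ X}`. -/
noncomputable abbrev ultraFam (S : Fam.{w} E) : Fam.{w} E :=
  ⟨Ultrafilter S.Idx, fun U => ultraproduct U S.obj⟩

theorem ultraFam_hom_ext {S Q : Fam.{w} E} (a b : S ⟶ ultraFam Q)
    (e : ∀ x, Fam.Hom.base a x = Fam.Hom.base b x)
    (h : ∀ (x : S.Idx) (H : Set Q.Idx) (hH : H ∈ Fam.Hom.base a x)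
      (hH' : H ∈ Fam.Hom.base b x),
      copr (Fam.Hom.base a x) Q.obj H hH ≫ Fam.Hom.map a x =
        copr (Fam.Hom.base b x) Q.obj H hH' ≫ Fam.Hom.map b x) : a = b := by
  obtain ⟨a, φ⟩ := a
  obtain ⟨b, ψ⟩ := b
  obtain rfl : a = b := funext e
  obtain rfl : φ = ψ := funext fun x =>
    ultraproduct.hom_ext (U := (a x : Ultrafilter Q.Idx)) (S := Q.obj) fun H hH => h x H hH hH
  rfl

/-- The map of ultraproducts `∏_{f_* 𝒰} R ⟶ ∏_𝒰 S` induced by a map of families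
`(S_x)_x ⟶ (R_y)_y`. -/
noncomputable def ultraMap {S R : Fam.{w} E} (f : S ⟶ R) (U : Ultrafilter S.Idx) :
    ultraproduct (U.map (Fam.Hom.base f)) R.obj ⟶ ultraproduct U S.obj :=
  desc _ _ (fun K hK => prodMap f K ≫ copr U S.obj (Fam.Hom.base f ⁻¹' K) (Ultrafilter.mem_map.1 hK)) (by
    intro H K hH hK h
    rw [← restrict_copr U S.obj (Set.preimage_mono h) hH hK, ← Category.assoc, ← Category.assoc]
    congr 1
    apply prodOn_hom_ext
    intro x hx
    rw [Category.assoc, Category.assoc, prodRestrict_π, prodMap_π, prodMap_π,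
      ← Category.assoc, prodRestrict_π])

theorem copr_ultraMap {S R : Fam.{w} E} (f : S ⟶ R) (U : Ultrafilter S.Idx) (K : Set R.Idx)
    (hK : K ∈ U.map (Fam.Hom.base f)) :
    copr (U.map (Fam.Hom.base f)) R.obj K hK ≫ ultraMap f U =
      prodMap f K ≫ copr U S.obj (Fam.Hom.base f ⁻¹' K) (Ultrafilter.mem_map.1 hK) :=
  copr_desc _ _ _ _ _ _

/-- The map of families of ultraproducts induced by a map of families. -/
noncomputable def ultraFamMap {S R : Fam.{w} E} (f : S ⟶ R) : ultraFam S ⟶ ultraFam R :=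
  ⟨fun U : Ultrafilter S.Idx => U.map (Fam.Hom.base f), fun U => ultraMap f U⟩

theorem ultraFamMap_id (S : Fam.{w} E) : ultraFamMap (𝟙 S) = 𝟙 (ultraFam S) := by
  refine ultraFam_hom_ext _ _ (fun U => Ultrafilter.map_id' U) fun U H hH hH' => ?_
  refine (copr_ultraMap (𝟙 S) U H hH).trans ?_
  refine Eq.trans ?_ (Category.comp_id _).symm
  refine Eq.trans ?_ (Category.id_comp _)
  congr 1
  apply prodOn_hom_ext
  intro x hx
  refine (prodMap_π (𝟙 S) H x hx).trans ?_
  exact (Category.comp_id _).trans (Category.id_comp _).symm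

theorem ultraFamMap_comp {S R Q : Fam.{w} E} (f : S ⟶ R) (g : R ⟶ Q) :
    ultraFamMap (f ≫ g) = ultraFamMap f ≫ ultraFamMap g := by
  refine ultraFam_hom_ext _ _
    (fun U => (Ultrafilter.map_map U (Fam.Hom.base f) (Fam.Hom.base g)).symm)
    fun U H hH hH' => ?_
  change Ultrafilter S.Idx at U
  change H ∈ U.map (Fam.Hom.base (f ≫ g)) at hH
  change H ∈ (U.map (Fam.Hom.base f)).map (Fam.Hom.base g) at hH'
  change copr (U.map (Fam.Hom.base (f ≫ g))) Q.obj H hH ≫ ultraMap (f ≫ g) U =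
    copr ((U.map (Fam.Hom.base f)).map (Fam.Hom.base g)) Q.obj H hH' ≫
      ultraMap g (U.map (Fam.Hom.base f)) ≫ ultraMap f U
  rw [copr_ultraMap, ← Category.assoc, copr_ultraMap, Category.assoc, copr_ultraMap,
    ← Category.assoc]
  change _ ≫ copr U S.obj (Fam.Hom.base f ⁻¹' (Fam.Hom.base g ⁻¹' H)) _ = _
  congr 1
  apply prodOn_hom_ext
  intro x hx
  refine (prodMap_π (f ≫ g) H x hx).trans ?_
  have hx' : Fam.Hom.base f x ∈ Fam.Hom.base g ⁻¹' H := hx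
  refine Eq.trans ?_ ((congrArg _ (prodMap_π f (Fam.Hom.base g ⁻¹' H) x hx')).symm.trans
    (Category.assoc _ _ _).symm)
  rw [← Category.assoc, prodMap_π, Category.assoc]
  rfl

/-- The canonical map `∏_{𝒰_x} S ⟶ S_x`, for `𝒰_x` the principal ultrafilter on `x`, given on
`∏_{y ∈ H} S_y` (where `x ∈ H`) by projection to the factor `S_x`. -/
noncomputable def ultraproductPure {X : Type w} (S : X → E) (x : X) :
    ultraproduct (pure x : Ultrafilter X) S ⟶ S x :=
  desc _ _ (fun H hH => Pi.π (fun y : H => S y) ⟨x, Ultrafilter.mem_pure.1 hH⟩)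
    (fun _ _ hH _ h => prodRestrict_π S h x hH)

theorem copr_ultraproductPure {X : Type w} (S : X → E) (x : X) (H : Set X)
    (hH : H ∈ (pure x : Ultrafilter X)) :
    copr (pure x : Ultrafilter X) S H hH ≫ ultraproductPure S x =
      Pi.π (fun y : H => S y) ⟨x, Ultrafilter.mem_pure.1 hH⟩ :=
  copr_desc _ _ _ _ _ _

/-- The unit of the ultraproduct monad at a family: on indexing sets, `x ↦ 𝒰_x`; on members, the
canonical map `∏_{𝒰_x} S ⟶ S_x`. -/
noncomputable def ultraFamUnit (S : Fam.{w} E) : S ⟶ ultraFam S :=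
  ⟨fun x => (pure x : Ultrafilter S.Idx), fun x => ultraproductPure S.obj x⟩

theorem ultraFamUnit_naturality {S R : Fam.{w} E} (f : S ⟶ R) :
    f ≫ ultraFamUnit R = ultraFamUnit S ≫ ultraFamMap f := by
  refine ultraFam_hom_ext _ _ (fun x => (Ultrafilter.map_pure _ _).symm) fun x H hH hH' => ?_
  change H ∈ (pure (Fam.Hom.base f x) : Ultrafilter R.Idx) at hH
  change H ∈ (pure x : Ultrafilter S.Idx).map (Fam.Hom.base f) at hH'
  change copr (pure (Fam.Hom.base f x) : Ultrafilter R.Idx) R.obj H hH ≫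
      ultraproductPure R.obj (Fam.Hom.base f x) ≫ Fam.Hom.map f x =
    copr ((pure x : Ultrafilter S.Idx).map (Fam.Hom.base f)) R.obj H hH' ≫
      ultraMap f (pure x) ≫ ultraproductPure S.obj x
  rw [← Category.assoc, copr_ultraproductPure, ← Category.assoc, copr_ultraMap, Category.assoc,
    copr_ultraproductPure]
  exact (prodMap_π f H x hH).symm

/-- The multiplication of the ultrafilter monad: `H` belongs to `ultraJoin 𝒲` if and only if
`{𝒰 | H ∈ 𝒰}` belongs to `𝒲`. -/
def ultraJoin {X : Type w} (W : Ultrafilter (Ultrafilter X)) : Ultrafilter X := W.bind id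

theorem mem_ultraJoin {X : Type w} {W : Ultrafilter (Ultrafilter X)} {H : Set X} :
    H ∈ ultraJoin W ↔ {U : Ultrafilter X | H ∈ U} ∈ W := Iff.rfl

/-- The map `∏_{x ∈ H} S_x ⟶ ∏_{𝒰 ∋ H} (∏_𝒰 S)` whose `𝒰`-component is the coprojection. -/
noncomputable def coprAll {X : Type w} (S : X → E) (H : Set X) :
    prodOn S H ⟶ prodOn (fun U : Ultrafilter X => ultraproduct U S) {U | H ∈ U} :=
  Pi.lift fun U : {U : Ultrafilter X | H ∈ U} => copr U.1 S H U.2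

theorem coprAll_π {X : Type w} (S : X → E) (H : Set X) (U : Ultrafilter X) (hU : H ∈ U) :
    coprAll S H ≫ Pi.π (fun U : {U : Ultrafilter X | H ∈ U} => ultraproduct U.1 S) ⟨U, hU⟩ =
      copr U S H hU := by
  simp [coprAll]

/-- The canonical map from the ultraproduct over `ultraJoin 𝒲` to the ultraproduct with respect
to `𝒲` of the family of ultraproducts `(∏_𝒰 S)_𝒰`. -/
noncomputable def ultraproductJoin {X : Type w} (S : X → E) (W : Ultrafilter (Ultrafilter X)) :
    ultraproduct (ultraJoin W) S ⟶ ultraproduct W fun U => ultraproduct U S :=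
  desc _ _ (fun H hH => coprAll S H ≫ copr W _ {U | H ∈ U} (mem_ultraJoin.1 hH)) (by
    intro H K hH hK h
    rw [← restrict_copr W (fun U => ultraproduct U S)
      (show {U : Ultrafilter X | H ∈ U} ⊆ {U | K ∈ U} from
        fun U hU => Filter.mem_of_superset hU h) hH hK, ← Category.assoc, ← Category.assoc]
    congr 1
    apply prodOn_hom_ext
    intro U hU
    rw [Category.assoc, Category.assoc, prodRestrict_π (fun U => ultraproduct U S)]
    erw [coprAll_π, coprAll_π]
    exact restrict_copr U S h hU _)

theorem copr_ultraproductJoin {X : Type w} (S : X → E) (W : Ultrafilter (Ultrafilter X))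
    (H : Set X) (hH : H ∈ ultraJoin W) :
    copr (ultraJoin W) S H hH ≫ ultraproductJoin S W =
      coprAll S H ≫ copr W (fun U => ultraproduct U S) {U | H ∈ U} (mem_ultraJoin.1 hH) :=
  copr_desc _ _ _ _ _ _

/-- The multiplication of the ultraproduct monad at a family. -/
noncomputable def ultraFamMul (S : Fam.{w} E) : ultraFam (ultraFam S) ⟶ ultraFam S :=
  ⟨fun W : Ultrafilter (Ultrafilter S.Idx) => ultraJoin W, fun W => ultraproductJoin S.obj W⟩

theorem ultraFamMul_naturality {S R : Fam.{w} E} (f : S ⟶ R) :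
    ultraFamMap (ultraFamMap f) ≫ ultraFamMul R = ultraFamMul S ≫ ultraFamMap f := by
  refine ultraFam_hom_ext _ _ (fun W => Ultrafilter.ext fun H => Iff.rfl) fun W H hH hH' => ?_
  change Ultrafilter (Ultrafilter S.Idx) at W
  change H ∈ ultraJoin (W.map (Fam.Hom.base (ultraFamMap f))) at hH
  change H ∈ (ultraJoin W).map (Fam.Hom.base f) at hH'
  change copr (ultraJoin (W.map (Fam.Hom.base (ultraFamMap f)))) R.obj H hH ≫
      ultraproductJoin R.obj (W.map (Fam.Hom.base (ultraFamMap f))) ≫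
        ultraMap (ultraFamMap f) W =
    copr ((ultraJoin W).map (Fam.Hom.base f)) R.obj H hH' ≫
      ultraMap f (ultraJoin W) ≫ ultraproductJoin S.obj W
  rw [← Category.assoc, copr_ultraproductJoin, Category.assoc, copr_ultraMap,
    ← Category.assoc (copr ((ultraJoin W).map (Fam.Hom.base f)) _ _ _),
    copr_ultraMap, Category.assoc, copr_ultraproductJoin]
  refine (Category.assoc _ _ _).symm.trans (Eq.trans ?_ (Category.assoc _ _ _))
  refine congrArg (· ≫ copr W (fun U : Ultrafilter S.Idx => ultraproduct U S.obj)
    {U : Ultrafilter S.Idx | Fam.Hom.base f ⁻¹' H ∈ U} hH) ?_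
  apply prodOn_hom_ext
  intro U hU
  refine (Category.assoc _ _ _).trans (Eq.trans ?_ (Category.assoc _ _ _).symm)
  refine (congrArg _ (prodMap_π (ultraFamMap f) {U : Ultrafilter R.Idx | H ∈ U} U hU)).trans ?_
  refine Eq.trans ?_ (congrArg _ (coprAll_π S.obj _ U hU)).symm
  refine (Category.assoc _ _ _).symm.trans ?_
  refine (congrArg (· ≫ ultraMap f U) (coprAll_π R.obj H (U.map (Fam.Hom.base f)) hU)).trans ?_
  exact copr_ultraMap f U H hU

theorem ultraFamMul_assoc (S : Fam.{w} E) :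
    ultraFamMap (ultraFamMul S) ≫ ultraFamMul S =
      ultraFamMul (ultraFam S) ≫ ultraFamMul S := by
  refine ultraFam_hom_ext _ _ (fun W => Ultrafilter.ext fun H => Iff.rfl) fun W H hH hH' => ?_
  change Ultrafilter (Ultrafilter (Ultrafilter S.Idx)) at W
  change H ∈ ultraJoin (W.map (Fam.Hom.base (ultraFamMul S))) at hH
  change H ∈ ultraJoin (ultraJoin W) at hH'
  change copr (ultraJoin (W.map (Fam.Hom.base (ultraFamMul S)))) S.obj H hH ≫
      ultraproductJoin S.obj (W.map (Fam.Hom.base (ultraFamMul S))) ≫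
        ultraMap (ultraFamMul S) W =
    copr (ultraJoin (ultraJoin W)) S.obj H hH' ≫
      ultraproductJoin S.obj (ultraJoin W) ≫ ultraproductJoin (ultraFam S).obj W
  rw [← Category.assoc, copr_ultraproductJoin, Category.assoc, ← Category.assoc (copr _ _ _ _),
    copr_ultraproductJoin, Category.assoc]
  refine (congrArg _ (copr_ultraMap (ultraFamMul S) W {U : Ultrafilter S.Idx | H ∈ U} hH)).trans ?_
  refine Eq.trans ?_ (congrArg _ (copr_ultraproductJoin (ultraFam S).obj W
    {U : Ultrafilter S.Idx | H ∈ U} hH)).symm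
  refine (Category.assoc _ _ _).symm.trans (Eq.trans ?_ (Category.assoc _ _ _))
  refine congrArg (· ≫ copr W (fun V : Ultrafilter (Ultrafilter S.Idx) =>
      ultraproduct V (ultraFam S).obj)
    {V : Ultrafilter (Ultrafilter S.Idx) | {U : Ultrafilter S.Idx | H ∈ U} ∈ V} hH) ?_
  apply prodOn_hom_ext
  intro V hV
  refine (Category.assoc _ _ _).trans (Eq.trans ?_ (Category.assoc _ _ _).symm)
  refine (congrArg _ (prodMap_π (ultraFamMul S) {U : Ultrafilter S.Idx | H ∈ U} V hV)).trans ?_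
  refine Eq.trans ?_ (congrArg _ (coprAll_π (ultraFam S).obj {U : Ultrafilter S.Idx | H ∈ U}
    V hV)).symm
  refine (Category.assoc _ _ _).symm.trans ?_
  refine (congrArg (· ≫ ultraproductJoin S.obj V)
    (coprAll_π S.obj H (ultraJoin V) hV)).trans ?_
  exact copr_ultraproductJoin S.obj V H hV

theorem ultraFamMul_left_unit (S : Fam.{w} E) :
    ultraFamUnit (ultraFam S) ≫ ultraFamMul S = 𝟙 (ultraFam S) := by
  refine ultraFam_hom_ext _ _ (fun W => Ultrafilter.ext fun H => Iff.rfl) fun U H hH hH' => ?_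
  change Ultrafilter S.Idx at U
  change H ∈ ultraJoin (pure U) at hH
  change H ∈ U at hH'
  change copr (ultraJoin (pure U)) S.obj H hH ≫ ultraproductJoin S.obj (pure U) ≫
      ultraproductPure (ultraFam S).obj U = copr U S.obj H hH' ≫ 𝟙 _
  rw [← Category.assoc, copr_ultraproductJoin, Category.assoc, Category.comp_id]
  refine (congrArg _ (copr_ultraproductPure (ultraFam S).obj U
    {U : Ultrafilter S.Idx | H ∈ U} hH)).trans ?_
  exact coprAll_π S.obj H U hH

theorem ultraFamMul_right_unit (S : Fam.{w} E) :
    ultraFamMap (ultraFamUnit S) ≫ ultraFamMul S = 𝟙 (ultraFam S) := by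
  refine ultraFam_hom_ext _ _ (fun W => Ultrafilter.ext fun H => Iff.rfl) fun U H hH hH' => ?_
  change Ultrafilter S.Idx at U
  change H ∈ ultraJoin (U.map (Fam.Hom.base (ultraFamUnit S))) at hH
  change H ∈ U at hH'
  change copr (ultraJoin (U.map (Fam.Hom.base (ultraFamUnit S)))) S.obj H hH ≫
      ultraproductJoin S.obj (U.map (Fam.Hom.base (ultraFamUnit S))) ≫
        ultraMap (ultraFamUnit S) U = copr U S.obj H hH' ≫ 𝟙 _
  rw [← Category.assoc, copr_ultraproductJoin, Category.assoc, Category.comp_id]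
  refine (congrArg _ (copr_ultraMap (ultraFamUnit S) U {U : Ultrafilter S.Idx | H ∈ U} hH)).trans ?_
  refine (Category.assoc _ _ _).symm.trans (Eq.trans ?_ (Category.id_comp _))
  refine congrArg (· ≫ copr U S.obj H hH') ?_
  apply prodOn_hom_ext
  intro x hx
  refine (Category.assoc _ _ _).trans (Eq.trans ?_ (Category.id_comp _).symm)
  refine (congrArg _ (prodMap_π (ultraFamUnit S) {U : Ultrafilter S.Idx | H ∈ U} x hx)).trans ?_
  refine (Category.assoc _ _ _).symm.trans ?_
  refine (congrArg (· ≫ ultraproductPure S.obj x)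
    (coprAll_π S.obj H (pure x : Ultrafilter S.Idx) hx)).trans ?_
  exact copr_ultraproductPure S.obj x H hx

end Ultraproduct

/-- The underlying functor of the ultraproduct monad:
`(S_x)_{x ∈ X} ↦ (∏_𝒰 S)_{𝒰 ∈ U(X)}`. -/
noncomputable def ultraproductFunctor (E : Type u) [Category.{v} E] [HasProducts.{w} E]
    [HasFilteredColimitsOfSize.{w, w} E] : Fam.{w} E ⥤ Fam.{w} E where
  obj S := ultraFam S
  map f := ultraFamMap f
  map_id S := ultraFamMap_id S
  map_comp f g := ultraFamMap_comp f g

/-- The ultraproduct monad on `Fam E`. -/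
noncomputable def ultraproductMonad (E : Type u) [Category.{v} E] [HasProducts.{w} E]
    [HasFilteredColimitsOfSize.{w, w} E] : CategoryTheory.Monad (Fam.{w} E) where
  toFunctor := ultraproductFunctor.{w} E
  η := { app := fun S => ultraFamUnit S
         naturality := fun _ _ f => ultraFamUnit_naturality f }
  μ := { app := fun S => ultraFamMul S
         naturality := fun _ _ f => ultraFamMul_naturality f }
  assoc S := ultraFamMul_assoc S
  left_unit S := ultraFamMul_left_unit S
  right_unit S := ultraFamMul_right_unit S

/-! A right Kan extension is unique up to a unique isomorphism compatible with the counits, and the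
codensity unit and multiplication are determined by their composites with the counit. So it suffices
to equip $V$ with a counit $\kappa$ making it a pointwise right Kan extension of the inclusion along
itself, and to check the two defining equations.

On a finite set every ultrafilter is principal, so $\eta_R\colon R\to V(R)$ is invertible for finite
$R$, and $\kappa_R$ is its inverse (`ultraFamUnit_counit`, `ultraFamCounit_unit`). Then
$\kappa\circ\eta=\mathrm{id}$ is immediate, and the unit law $\mu\circ V\eta=\mathrm{id}$ forces
$\mu=V\kappa$ at finite families.

For the limit property, every map $(f,\phi)$ from $S$ to a finite family factors through the finite
family of products of $S$ over the fibres of $f$ (`toFibreFam_desc`), so a cone with vertex $Z$ is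
determined by its legs at fibre families. At an index $i$ of $Z$, these legs select one fibre of
each function to a finite set, compatibly with coarsening, which amounts to an ultrafilter
$\mathcal{U}$ (`large_preimage`). They also give maps $\prod_{x\in H}S_x\to Z_i$ for
$H\in\mathcal{U}$, compatible with restriction (`restrict_proj`), hence a map
$\prod_{\mathcal{U}}S\to Z_i$. Together these form a map $Z\to V(S)$; `FibreCone.lift_map` shows
that it induces the cone, and `ultraFam_hom_ext_of_fibre` that it is the only one to do so. -/

/-! ### Recognising a codensity monad. -/

section Codensity

variable {B : Type u₁} [Category.{v₁} B] {A : Type u₂} [Category.{v₂} A]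

/-- A monad `M` with a transformation `κ : M G ⟶ G` exhibiting it as the right Kan extension of
`G` along itself, and satisfying the defining equations of the codensity monad, is isomorphic to
the codensity monad of `G`. -/
theorem nonempty_codensityMonad_iso (G : B ⥤ A) [HasCodensityMonad G]
    (M : CategoryTheory.Monad A) (κ : G ⋙ M.toFunctor ⟶ G)
    [M.toFunctor.IsRightKanExtension κ]
    (hη : ∀ b, M.η.app (G.obj b) ≫ κ.app b = 𝟙 (G.obj b))
    (hμ : ∀ b, M.μ.app (G.obj b) ≫ κ.app b = M.map (κ.app b) ≫ κ.app b) :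
    Nonempty (codensityMonad G ≅ M) := by
  let e : M.toFunctor ≅ codensityFunctor G :=
    M.toFunctor.rightKanExtensionUnique κ (codensityFunctor G) (codensityCounit G)
  have he : ∀ b, e.hom.app (G.obj b) ≫ (codensityCounit G).app b = κ.app b := fun b => by
    simp only [e, Functor.rightKanExtensionUnique_hom]
    exact (codensityFunctor G).liftOfIsRightKanExtension_fac_app (codensityCounit G)
      M.toFunctor κ b
  have e_η : M.η ≫ e.hom = codensityUnit G := by
    apply codensity_hom_ext
    intro b
    rw [NatTrans.comp_app, Category.assoc, he, hη, codensityUnit_fac]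
  have e_μ : M.μ ≫ e.hom =
      Functor.whiskerRight e.hom M.toFunctor ≫
        Functor.whiskerLeft (codensityFunctor G) e.hom ≫ codensityMul G := by
    apply codensity_hom_ext
    intro b
    simp only [NatTrans.comp_app, Functor.whiskerRight_app, Functor.whiskerLeft_app,
      Category.assoc]
    -- Naturality of `e` at the codensity counit moves `e` past it; two uses of `he` then reduce the
    -- right side to `M.map (κ.app b) ≫ κ.app b`.
    rw [he, hμ, codensityMul_fac, ← e.hom.naturality_assoc, he, ← Functor.map_comp_assoc, he]
  exact ⟨(MonadIso.mk (M := M) (N := codensityMonad G) e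
    (fun a => congrArg (fun t => t.app a) e_η)
    (fun a => by
      refine (congrArg (fun t => t.app a) e_μ).trans ?_
      exact (Category.assoc _ _ _).symm)).symm⟩

end Codensity

/-! ### Ultraproducts over finite index sets: the unit is invertible. -/

section Ultraproduct

open ultraproduct

variable {E : Type u} [Category.{v} E] [HasProducts.{w} E]

theorem prodRestrict_comp {X : Type w} (S : X → E) {H K L : Set X} (h : H ⊆ K) (k : K ⊆ L) :
    prodRestrict S k ≫ prodRestrict S h = prodRestrict S (h.trans k) :=
  prodOn_hom_ext fun x hx => by
    rw [Category.assoc, prodRestrict_π, prodRestrict_π, prodRestrict_π]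

variable [HasFilteredColimitsOfSize.{w, w} E]

/-- The map `S_x ⟶ ∏_𝒰 S`, for an ultrafilter `𝒰` containing `{x}`. -/
noncomputable def singletonCopr {X : Type w} (S : X → E) (U : Ultrafilter X) (x : X)
    (hx : {x} ∈ U) : S x ⟶ ultraproduct U S :=
  Pi.lift (fun y : ({x} : Set X) => eqToHom (congrArg S (Set.mem_singleton_iff.1 y.2).symm)) ≫
    copr U S {x} hx

/-- The set `{x}` is contained in every `H` that contains `x`, so the coprojection at `H` factors
through the one at `{x}`. Assuming `{x} ∈ U` rather than `U = pure x` avoids transporting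
ultraproducts along an equality of ultrafilters. -/
theorem π_singletonCopr {X : Type w} (S : X → E) (U : Ultrafilter X) (x : X) (hx : {x} ∈ U)
    (H : Set X) (hH : H ∈ U) (hxH : x ∈ H) :
    Pi.π (fun y : H => S y) ⟨x, hxH⟩ ≫ singletonCopr S U x hx = copr U S H hH := by
  rw [← restrict_copr U S (Set.singleton_subset_iff.2 hxH) hx hH, singletonCopr,
    ← Category.assoc]
  congr 1
  refine prodOn_hom_ext fun y hy => ?_
  obtain rfl : y = x := hy
  refine (Category.assoc _ _ _).trans ((congrArg _ (Pi.lift_π _ _)).trans ?_)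
  exact (Category.comp_id _).trans (prodRestrict_π S (Set.singleton_subset_iff.2 hxH) y
    (Set.mem_singleton y)).symm

theorem singletonCopr_ultraproductPure {X : Type w} (S : X → E) (x y : X)
    (hy : {y} ∈ (pure x : Ultrafilter X)) (h : y = x) :
    singletonCopr S (pure x) y hy ≫ ultraproductPure S x = eqToHom (congrArg S h) := by
  subst h
  rw [singletonCopr, Category.assoc, copr_ultraproductPure, Pi.lift_π]

theorem exists_singleton_mem {X : Type w} [Finite X] (U : Ultrafilter X) : ∃ x, {x} ∈ U := by
  obtain ⟨x, rfl⟩ := Ultrafilter.eq_pure_of_finite U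
  exact ⟨x, Set.mem_singleton x⟩

theorem eq_pure_of_singleton_mem {X : Type w} {U : Ultrafilter X} {x : X} (h : {x} ∈ U) :
    U = pure x :=
  Ultrafilter.eq_of_le (Filter.le_pure_iff.2 h)

/-- The inverse of the unit of the ultraproduct monad at a finite family. -/
noncomputable def ultraFamCounit (S : Fam.{w} E) [Finite S.Idx] : ultraFam S ⟶ S :=
  ⟨fun U : Ultrafilter S.Idx => (exists_singleton_mem U).choose, fun U =>
    singletonCopr S.obj U _ (exists_singleton_mem U).choose_spec⟩

theorem ultraFamUnit_counit (S : Fam.{w} E) [Finite S.Idx] :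
    ultraFamUnit S ≫ ultraFamCounit S = 𝟙 S := by
  have h (x : S.Idx) : (exists_singleton_mem (pure x : Ultrafilter S.Idx)).choose = x :=
    (Set.mem_singleton_iff.1 (Ultrafilter.mem_pure.1
      (exists_singleton_mem (pure x : Ultrafilter S.Idx)).choose_spec)).symm
  refine Fam.hom_ext _ _ h fun x => ?_
  refine (singletonCopr_ultraproductPure S.obj x _ _ (h x)).trans ?_
  exact (Category.comp_id _).symm

theorem ultraFamCounit_unit (S : Fam.{w} E) [Finite S.Idx] :
    ultraFamCounit S ≫ ultraFamUnit S = 𝟙 (ultraFam S) := by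
  refine ultraFam_hom_ext _ _
    (fun U => (eq_pure_of_singleton_mem (exists_singleton_mem U).choose_spec).symm)
    fun U H hH hH' => ?_
  refine (Category.assoc _ _ _).symm.trans ?_
  refine (congrArg (· ≫ _) (copr_ultraproductPure S.obj _ H hH)).trans ?_
  refine Eq.trans ?_ (Category.comp_id _).symm
  exact π_singletonCopr S.obj U _ _ H hH' _

/-- Since the counit at a finite family is invertible, equations after the counit can be turned into
equations in the family of ultraproducts. -/
theorem eq_comp_ultraFamUnit {S Z : Fam.{w} E} [Finite S.Idx] (c : Z ⟶ ultraFam S) (t : Z ⟶ S)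
    (h : c ≫ ultraFamCounit S = t) : c = t ≫ ultraFamUnit S := by
  rw [← h, Category.assoc, ultraFamCounit_unit, Category.comp_id]

end Ultraproduct

/-! ### Finite partitions, ultrafilters, and maps into families of ultraproducts. -/

section Partition

variable {E : Type u} [Category.{v} E] [HasProducts.{w} E]

/-- The family `(∏_{x ∈ f⁻¹ b} S_x)_b`, for `f` a function from the indexing set of `S` to a
finite set. -/
noncomputable def fibreFam (S : Fam.{w} E) {n : Type w} [hn : Finite n] (f : S.Idx → n) :
    FinFam.{w} E :=
  ⟨⟨n, fun b => prodOn S.obj (f ⁻¹' {b})⟩, hn⟩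

/-- The canonical map from `S` to the family of products over the fibres of `f`. -/
noncomputable def toFibreFam (S : Fam.{w} E) {n : Type w} [Finite n] (f : S.Idx → n) :
    S ⟶ (finFamInclusion E).obj (fibreFam S f) :=
  ⟨f, fun x => Pi.π (fun y : (f ⁻¹' {f x} : Set S.Idx) => S.obj y) ⟨x, rfl⟩⟩

/-- Coarsening a partition. -/
noncomputable def coarsen (S : Fam.{w} E) {n m : Type w} [Finite n] [Finite m]
    (f : S.Idx → n) (g : n → m) : (fibreFam S f).obj ⟶ (fibreFam S (g ∘ f)).obj :=
  ⟨g, fun _ => prodRestrict S.obj (fun _ hx => congrArg g hx)⟩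

theorem toFibreFam_coarsen (S : Fam.{w} E) {n m : Type w} [Finite n] [Finite m]
    (f : S.Idx → n) (g : n → m) : toFibreFam S f ≫ coarsen S f g = toFibreFam S (g ∘ f) := by
  refine Fam.hom_ext _ _ (fun _ => rfl) fun x => ?_
  have h : f ⁻¹' {f x} ⊆ (g ∘ f) ⁻¹' {(g ∘ f) x} := fun _ hx => congrArg g hx
  exact (prodRestrict_π S.obj h x rfl).trans (Category.id_comp _).symm

/-- The comparison between the products over the fibres of a map to a finite family and that
family. -/
noncomputable def fibreDesc {S R : Fam.{w} E} [Finite R.Idx] (f : S ⟶ R) :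
    (fibreFam S (Fam.Hom.base f)).obj ⟶ R :=
  ⟨id, fun b => Pi.lift fun x : (Fam.Hom.base f ⁻¹' {b} : Set S.Idx) =>
    eqToHom (congrArg R.obj (Set.mem_singleton_iff.1 x.2).symm) ≫ Fam.Hom.map f x.1⟩

theorem fibreDesc_π {S R : Fam.{w} E} [Finite R.Idx] (f : S ⟶ R) (b : R.Idx) (x : S.Idx)
    (hx : Fam.Hom.base f x = b) :
    Fam.Hom.map (fibreDesc f) b ≫
        Pi.π (fun y : (Fam.Hom.base f ⁻¹' {b} : Set S.Idx) => S.obj y) ⟨x, hx⟩ =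
      eqToHom (congrArg R.obj hx.symm) ≫ Fam.Hom.map f x :=
  Pi.lift_π _ _

/-- This factorisation makes the fibre families enough to control a cone over all finite families
under `S`. -/
theorem toFibreFam_desc {S R : Fam.{w} E} [Finite R.Idx] (f : S ⟶ R) :
    toFibreFam S (Fam.Hom.base f) ≫ fibreDesc f = f := by
  refine Fam.hom_ext _ _ (fun _ => rfl) fun x => ?_
  exact Pi.lift_π _ _

/-- The map `∏_{x ∈ A} S_x ⟶ Z_i` obtained from a map `Z ⟶ (∏_{x ∈ f⁻¹ b} S_x)_b` when `A`
contains the fibre picked out by `i`. -/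
noncomputable def fibreProj {S Z : Fam.{w} E} {n : Type w} [Finite n] {f : S.Idx → n}
    (q : Z ⟶ (fibreFam S f).obj) (i : Z.Idx) (A : Set S.Idx)
    (h : f ⁻¹' {Fam.Hom.base q i} ⊆ A) : prodOn S.obj A ⟶ Z.obj i :=
  prodRestrict S.obj h ≫ Fam.Hom.map q i

theorem restrict_fibreProj {S Z : Fam.{w} E} {n : Type w} [Finite n] {f : S.Idx → n}
    (q : Z ⟶ (fibreFam S f).obj) (i : Z.Idx) {A A' : Set S.Idx}
    (h : f ⁻¹' {Fam.Hom.base q i} ⊆ A) (hA : A ⊆ A') :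
    prodRestrict S.obj hA ≫ fibreProj q i A h = fibreProj q i A' (h.trans hA) := by
  refine (Category.assoc _ _ _).symm.trans ?_
  exact congrArg (· ≫ Fam.Hom.map q i) (prodRestrict_comp S.obj h hA)

/-- The member maps of `coarsen` are themselves restrictions, so both sides restrict from `A` to the
fibre of `f` and then apply the map of `q`. -/
theorem fibreProj_coarsen {S Z : Fam.{w} E} {n m : Type w} [Finite n] [Finite m]
    {f : S.Idx → n} (g : n → m) (q : Z ⟶ (fibreFam S f).obj)
    (q' : Z ⟶ (fibreFam S (g ∘ f)).obj) (hq : q ≫ coarsen S f g = q') (i : Z.Idx)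
    (A : Set S.Idx) (h : f ⁻¹' {Fam.Hom.base q i} ⊆ A)
    (h' : (g ∘ f) ⁻¹' {Fam.Hom.base q' i} ⊆ A) :
    fibreProj q' i A h' = fibreProj q i A h := by
  subst hq
  refine (Category.assoc _ _ _).symm.trans ?_
  have h'' : f ⁻¹' {Fam.Hom.base q i} ⊆ (g ∘ f) ⁻¹' {g (Fam.Hom.base q i)} :=
    fun _ hx => congrArg g hx
  exact congrArg (· ≫ Fam.Hom.map q i) (prodRestrict_comp S.obj h'' h')

/-- The characteristic function of a set. -/
def charFun {X : Type w} (H : Set X) (x : X) : ULift.{w} Prop := ⟨x ∈ H⟩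

theorem charFun_preimage_subset {X : Type w} (H : Set X) (P : ULift.{w} Prop) (hP : P.down) :
    charFun H ⁻¹' {P} ⊆ H := fun x hx => by
  have : charFun H x = P := hx
  rw [← this] at hP
  exact hP

/-- A family of maps from `Z` to the families of products over finite partitions of `S`,
compatible with coarsening. -/
structure FibreCone (S Z : Fam.{w} E) where
  /-- the maps -/
  leg : ∀ {n : Type w} [Finite n] (f : S.Idx → n), Z ⟶ (fibreFam S f).obj
  /-- compatibility with coarsening -/
  w : ∀ {n m : Type w} [Finite n] [Finite m] (f : S.Idx → n) (g : n → m),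
    leg f ≫ coarsen S f g = leg (g ∘ f)

namespace FibreCone

variable {S Z : Fam.{w} E} (p : FibreCone S Z) (i : Z.Idx)

/-- The fibre of `f` picked out by `i`. -/
noncomputable def val {n : Type w} [Finite n] (f : S.Idx → n) : n := Fam.Hom.base (p.leg f) i

theorem val_comp {n m : Type w} [Finite n] [Finite m] (f : S.Idx → n) (g : n → m) :
    p.val i (g ∘ f) = g (p.val i f) := by
  rw [val, ← p.w]
  rfl

/-- The sets picked out by `i`. -/
def Large (H : Set S.Idx) : Prop := (p.val i (charFun H)).down

/-- The function `charFun (f ⁻¹' A)` is by definition `charFun A ∘ f`, so compatibility with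
coarsening suffices. Each ultrafilter axiom then becomes a statement about one point `p.val i f` of
a finite set, for a suitable `f`. -/
theorem large_preimage {n : Type w} [Finite n] (f : S.Idx → n) (A : Set n) :
    p.Large i (f ⁻¹' A) ↔ p.val i f ∈ A :=
  Iff.of_eq (congrArg ULift.down (p.val_comp i f (charFun A)))

theorem large_univ : p.Large i Set.univ :=
  (p.large_preimage i (charFun (Set.univ : Set S.Idx)) Set.univ).2 trivial

theorem large_compl (H : Set S.Idx) : p.Large i Hᶜ ↔ ¬ p.Large i H :=
  p.large_preimage i (charFun H) {P | ¬ P.down}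

theorem large_inter (H K : Set S.Idx) : p.Large i (H ∩ K) ↔ p.Large i H ∧ p.Large i K := by
  -- The common refinement of the partitions given by `H` and `K`; all three sets involved are
  -- preimages under it.
  let f : S.Idx → ULift.{w} Prop × ULift.{w} Prop := fun x => (charFun H x, charFun K x)
  have h1 := p.large_preimage i f {P | P.1.down}
  have h2 := p.large_preimage i f {P | P.2.down}
  have h3 := p.large_preimage i f {P | P.1.down ∧ P.2.down}
  exact h3.trans (and_congr h1 h2).symm

/-- The ultrafilter of the sets picked out by `i`. -/
def ultrafilter : Ultrafilter S.Idx :=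
  Ultrafilter.ofComplNotMemIff
    { sets := {H | p.Large i H}
      univ_sets := p.large_univ i
      sets_of_superset := fun {H K} hH h => by
        rw [← Set.inter_eq_left.2 h] at hH
        exact ((p.large_inter i H K).1 hH).2
      inter_sets := fun {H K} hH hK => (p.large_inter i H K).2 ⟨hH, hK⟩ }
    fun H => (not_congr (p.large_compl i H)).trans not_not

/-- The map `∏_{x ∈ H} S_x ⟶ Z_i` for `H` in the ultrafilter of `i`. -/
noncomputable def proj (H : Set S.Idx) (hH : H ∈ p.ultrafilter i) :
    prodOn S.obj H ⟶ Z.obj i :=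
  fibreProj (p.leg (charFun H)) i H (charFun_preimage_subset H _ hH)

/-- The projection at `H` may be computed from any finite partition that refines the one into `H`
and its complement. This allows two projections to be compared on a common refinement. -/
theorem proj_eq (H : Set S.Idx) (hH : H ∈ p.ultrafilter i) {n : Type w} [Finite n]
    (f : S.Idx → n) (g : n → ULift.{w} Prop) (hg : g ∘ f = charFun H)
    (h : f ⁻¹' {Fam.Hom.base (p.leg f) i} ⊆ H) :
    p.proj i H hH = fibreProj (p.leg f) i H h := by
  -- The type of the leg depends on the function, so `charFun H` is generalised to a variable before
  -- the equation is eliminated.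
  have key : ∀ (k : S.Idx → ULift.{w} Prop) (hk : g ∘ f = k)
      (h' : k ⁻¹' {Fam.Hom.base (p.leg k) i} ⊆ H),
      fibreProj (p.leg k) i H h' = fibreProj (p.leg f) i H h := by
    rintro k rfl h'
    exact fibreProj_coarsen g _ _ (p.w f g) i H h h'
  exact key _ hg _

theorem restrict_proj (H K : Set S.Idx) (hH : H ∈ p.ultrafilter i) (hK : K ∈ p.ultrafilter i)
    (h : H ⊆ K) : prodRestrict S.obj h ≫ p.proj i H hH = p.proj i K hK := by
  let f : S.Idx → ULift.{w} Prop × ULift.{w} Prop := fun x => (charFun H x, charFun K x)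
  -- As `H` is large, the selected block of the common refinement lies in `H`, hence also in `K`,
  -- and serves for both projections.
  have hf : f ⁻¹' {Fam.Hom.base (p.leg f) i} ⊆ H := fun x hx => by
    have h1 : (p.val i f).1.down := (p.large_preimage i f {P | P.1.down}).1 hH
    have h2 : f x = p.val i f := hx
    rw [← h2] at h1
    exact h1
  rw [p.proj_eq i H hH f Prod.fst rfl hf, p.proj_eq i K hK f Prod.snd rfl (hf.trans h),
    restrict_fibreProj]

variable [HasFilteredColimitsOfSize.{w, w} E]

open ultraproduct

/-- The map to the family of ultraproducts induced by a compatible family of maps. -/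
noncomputable def lift : Z ⟶ ultraFam S :=
  ⟨fun i => p.ultrafilter i, fun i => desc _ _ (p.proj i) (p.restrict_proj i)⟩

/-- On indices, `large_preimage` says that the pushforward along `f` of the ultrafilter of `i` is
principal at the selected value. On members, the partition into fibres of `f` computes the
projection at every preimage of `H`, and both sides agree on each coordinate in the selected fibre.
-/
theorem lift_map {R : Fam.{w} E} [Finite R.Idx] (f : S ⟶ R) :
    p.lift ≫ ultraFamMap f = (p.leg (Fam.Hom.base f) ≫ fibreDesc f) ≫ ultraFamUnit R := by
  refine ultraFam_hom_ext _ _ (fun i => Ultrafilter.ext fun H =>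
    p.large_preimage i (Fam.Hom.base f) H) fun i H hH hH' => ?_
  change H ∈ (p.ultrafilter i).map (Fam.Hom.base f) at hH
  change copr ((p.ultrafilter i).map (Fam.Hom.base f)) R.obj H hH ≫
      ultraMap f (p.ultrafilter i) ≫ desc _ _ (p.proj i) (p.restrict_proj i) =
    copr (pure (p.val i (Fam.Hom.base f))) R.obj H hH' ≫
      ultraproductPure R.obj (p.val i (Fam.Hom.base f)) ≫
        Fam.Hom.map (p.leg (Fam.Hom.base f) ≫ fibreDesc f) i
  have hv : p.val i (Fam.Hom.base f) ∈ H := hH'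
  rw [← Category.assoc, copr_ultraMap, Category.assoc, copr_desc]
  refine Eq.trans ?_ ((congrArg (· ≫ _) (copr_ultraproductPure R.obj _ H hH')).symm.trans
    (Category.assoc _ _ _))
  refine (congrArg (prodMap f H ≫ ·) (p.proj_eq i (Fam.Hom.base f ⁻¹' H) hH (Fam.Hom.base f)
    (charFun H) rfl (Set.preimage_mono (Set.singleton_subset_iff.2 hv)))).trans ?_
  refine (Category.assoc _ _ _).symm.trans (Eq.trans ?_ (Category.assoc _ _ _))
  refine congrArg (· ≫ Fam.Hom.map (p.leg (Fam.Hom.base f)) i) ?_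
  refine prodOn_hom_ext fun x hx => ?_
  refine (Category.assoc _ _ _).trans ?_
  refine (congrArg _ (prodRestrict_π S.obj _ x hx)).trans ?_
  refine (prodMap_π f H x _).trans ?_
  refine Eq.trans ?_ (Category.assoc _ _ _).symm
  have hx' : Fam.Hom.base f x = p.val i (Fam.Hom.base f) := hx
  refine Eq.trans ?_ (congrArg _ (fibreDesc_π f _ x hx').symm)
  -- The selected value is generalised to a variable `b`, so that `f x = b` can be substituted and
  -- the transport disappears.
  have key : ∀ (b : R.Idx) (hb : b ∈ H) (e : Fam.Hom.base f x = b) (hfx : Fam.Hom.base f x ∈ H),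
      Pi.π (fun y : H => R.obj y) ⟨Fam.Hom.base f x, hfx⟩ ≫ Fam.Hom.map f x =
        Pi.π (fun y : H => R.obj y) ⟨b, hb⟩ ≫ eqToHom (congrArg R.obj e.symm) ≫
          Fam.Hom.map f x := by
    rintro b hb rfl hfx
    rw [eqToHom_refl, Category.id_comp]
  exact key _ hv hx' _

end FibreCone

open ultraproduct

/-- Maps into the family of ultraproducts of `S` are determined by their composites with the maps
induced by `S ⟶ (∏_{x ∈ f⁻¹ b} S_x)_b`. -/
theorem ultraFam_hom_ext_of_fibre [HasFilteredColimitsOfSize.{w, w} E] {S Z : Fam.{w} E}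
    (a b : Z ⟶ ultraFam S)
    (h : ∀ {n : Type w} [Finite n] (f : S.Idx → n),
      a ≫ ultraFamMap (toFibreFam S f) = b ≫ ultraFamMap (toFibreFam S f)) : a = b := by
  -- The set `H` is the preimage of the true value under `charFun H`, so a two-block partition
  -- already detects whether `H` is a member.
  have mem_iff (c : Z ⟶ ultraFam S) (i : Z.Idx) (H : Set S.Idx) :
      H ∈ (Fam.Hom.base c i : Ultrafilter S.Idx) ↔ {P : ULift.{w} Prop | P.down} ∈
        (Fam.Hom.base (c ≫ ultraFamMap (toFibreFam S (charFun H))) i :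
          Ultrafilter (ULift.{w} Prop)) := Iff.rfl
  refine ultraFam_hom_ext a b (fun i => Ultrafilter.ext fun H => ?_) fun i H hH hH' => ?_
  · rw [mem_iff, h, ← mem_iff]
  · let T : Set (ULift.{w} Prop) := {P | P.down}
    let R := (fibreFam S (charFun H)).obj
    -- The only element of `T` is the true value, and its fibre is `H`. So `t` regards a product
    -- over `H` as a one-fold product of such products, and it is a section of `prodMap`; the
    -- coprojection at `H` can thus be recovered after passing to `R`.
    let t : prodOn S.obj H ⟶ prodOn R.obj T :=
      Pi.lift fun P : T => prodRestrict S.obj (charFun_preimage_subset H P.1 P.2)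
    have key (c : Z ⟶ ultraFam S) (hc : H ∈ (Fam.Hom.base c i : Ultrafilter S.Idx)) :
        copr (Fam.Hom.base c i) S.obj H hc ≫ Fam.Hom.map c i =
          t ≫ copr (Fam.Hom.base (c ≫ ultraFamMap (toFibreFam S (charFun H))) i) R.obj T hc ≫
            Fam.Hom.map (c ≫ ultraFamMap (toFibreFam S (charFun H))) i := by
      have e : t ≫ prodMap (toFibreFam S (charFun H)) T = 𝟙 _ := by
        refine prodOn_hom_ext fun x hx => ?_
        refine (Category.assoc _ _ _).trans ?_
        refine (congrArg _ (prodMap_π (toFibreFam S (charFun H)) T x hx)).trans ?_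
        refine (Category.assoc _ _ _).symm.trans ?_
        refine (congrArg (· ≫ _) (Pi.lift_π _ _)).trans ?_
        exact (prodRestrict_π S.obj _ x _).trans (Category.id_comp _).symm
      have e' := copr_ultraMap (toFibreFam S (charFun H)) (Fam.Hom.base c i) T hc
      symm
      refine (congrArg (t ≫ ·) ((Category.assoc _ _ _).symm.trans
        (congrArg (· ≫ Fam.Hom.map c i) e'))).trans ?_
      refine (congrArg (t ≫ ·) (Category.assoc _ _ _)).trans ?_
      refine (Category.assoc _ _ _).symm.trans ?_
      exact (congrArg (· ≫ _) e).trans (Category.id_comp _)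
    -- The source of the member map depends on the index map, so the equation from `h` is applied by
    -- substituting whole morphisms.
    have cong : ∀ (c d : Z ⟶ ultraFam R) (_ : c = d)
        (hc : T ∈ (Fam.Hom.base c i : Ultrafilter R.Idx))
        (hd : T ∈ (Fam.Hom.base d i : Ultrafilter R.Idx)),
        copr (Fam.Hom.base c i) R.obj T hc ≫ Fam.Hom.map c i =
          copr (Fam.Hom.base d i) R.obj T hd ≫ Fam.Hom.map d i := by
      rintro c _ rfl _ _
      rfl
    exact (key a hH).trans ((congrArg (t ≫ ·) (cong _ _ (h _) _ _)).trans (key b hH').symm)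

end Partition

/-! ### The ultraproduct functor as a pointwise right Kan extension. -/

section Extension

variable (E : Type u) [Category.{v} E] [HasProducts.{w} E]

instance finFam_finite (S : FinFam.{w} E) : Finite ((finFamInclusion.{w} E).obj S).Idx :=
  S.property

/-- A cone over the finite families under `S` restricts to the families of products over the
fibres of maps from `S.Idx` to finite sets. -/
noncomputable def FibreCone.ofCone {S : Fam.{w} E}
    (s : Cone (StructuredArrow.proj S (finFamInclusion.{w} E) ⋙ finFamInclusion.{w} E)) :
    FibreCone S s.pt where
  leg f := s.π.app (StructuredArrow.mk (toFibreFam S f))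
  w f g := s.w (StructuredArrow.homMk (ObjectProperty.homMk (coarsen S f g))
    (toFibreFam_coarsen S f g) :
      StructuredArrow.mk (toFibreFam S f) ⟶ StructuredArrow.mk (toFibreFam S (g ∘ f)))

theorem FibreCone.ofCone_leg_desc {S : Fam.{w} E}
    (s : Cone (StructuredArrow.proj S (finFamInclusion.{w} E) ⋙ finFamInclusion.{w} E))
    (a : StructuredArrow S (finFamInclusion.{w} E)) :
    (FibreCone.ofCone E s).leg (Fam.Hom.base a.hom) ≫ fibreDesc a.hom = s.π.app a :=
  s.w (StructuredArrow.homMk (ObjectProperty.homMk (fibreDesc a.hom)) (toFibreFam_desc a.hom) :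
    StructuredArrow.mk (toFibreFam S (Fam.Hom.base a.hom)) ⟶ a)

variable [HasFilteredColimitsOfSize.{w, w} E]

/-- The inverses of the units of the ultraproduct monad at finite families. -/
noncomputable def ultraproductCounit :
    finFamInclusion.{w} E ⋙ ultraproductFunctor.{w} E ⟶ finFamInclusion.{w} E where
  app S := ultraFamCounit ((finFamInclusion.{w} E).obj S)
  naturality S R f := by
    let f' := (finFamInclusion.{w} E).map f
    change ultraFamMap f' ≫ ultraFamCounit _ = ultraFamCounit _ ≫ f'
    -- The inverse of a natural isomorphism is natural: insert counit followed by unit, move the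
    -- unit past `f'`, and cancel.
    rw [← Category.id_comp (ultraFamMap f'), ← ultraFamCounit_unit, Category.assoc,
      Category.assoc, ← Category.assoc (ultraFamUnit _), ← ultraFamUnit_naturality,
      Category.assoc, ultraFamUnit_counit, Category.comp_id]

/-- The ultraproduct functor is the pointwise right Kan extension of the inclusion of the finite
families along itself. -/
noncomputable def ultraproductIsPointwiseRightKanExtension :
    (Functor.RightExtension.mk (ultraproductFunctor.{w} E)
      (ultraproductCounit.{w} E)).IsPointwiseRightKanExtension := fun S =>
  { lift := fun s => (FibreCone.ofCone E s).lift
    fac := fun s a => by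
      change (FibreCone.ofCone E s).lift ≫ ultraFamMap a.hom ≫ ultraFamCounit _ = s.π.app a
      rw [← Category.assoc, FibreCone.lift_map, Category.assoc, ultraFamUnit_counit,
        Category.comp_id, FibreCone.ofCone_leg_desc]
    uniq := fun s m hm => by
      refine ultraFam_hom_ext_of_fibre m (FibreCone.ofCone E s).lift fun f => ?_
      -- At a fibre family the factorisation hypothesis determines `m` after the counit; inverting
      -- the counit gives the same expression that `FibreCone.lift_map` gives for the lift.
      refine (eq_comp_ultraFamUnit (S := (finFamInclusion.{w} E).obj (fibreFam S f)) _
        (s.π.app (StructuredArrow.mk (toFibreFam S f)))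
        ((Category.assoc _ _ _).trans (hm (StructuredArrow.mk (toFibreFam S f))))).trans ?_
      rw [← FibreCone.ofCone_leg_desc]
      exact (FibreCone.lift_map _ _).symm }

end Extension

/-! ### The isomorphism of monads. -/

theorem mainTheorem3 (E : Type u) [Category.{v} E] [HasProducts.{w} E]
    [HasFilteredColimitsOfSize.{w, w} E] :
    ∃ _ : HasCodensityMonad (finFamInclusion.{w} E),
      Nonempty (codensityMonad (finFamInclusion.{w} E) ≅ ultraproductMonad.{w} E) := by
  have h := ultraproductIsPointwiseRightKanExtension.{w} E
  have : HasCodensityMonad (finFamInclusion.{w} E) := h.hasPointwiseRightKanExtension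
  have : (ultraproductMonad.{w} E).toFunctor.IsRightKanExtension (ultraproductCounit.{w} E) :=
    h.isRightKanExtension
  refine ⟨inferInstance, nonempty_codensityMonad_iso _ _ (ultraproductCounit.{w} E)
    (fun S => ultraFamUnit_counit ((finFamInclusion.{w} E).obj S)) fun S => ?_⟩
  let R := (finFamInclusion.{w} E).obj S
  change ultraFamMul R ≫ ultraFamCounit R = ultraFamMap (ultraFamCounit R) ≫ ultraFamCounit R
  have h' : ultraFamMap (ultraFamCounit R) ≫ ultraFamMap (ultraFamUnit R) = 𝟙 _ := by
    rw [← ultraFamMap_comp, ultraFamCounit_unit, ultraFamMap_id]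
  -- By the unit law, the multiplication is a one-sided inverse of $V\eta_R$, which is invertible
  -- with inverse $V\kappa_R$ because $R$ is finite.
  have h'' : ultraFamMul R = ultraFamMap (ultraFamCounit R) := by
    rw [← Category.id_comp (ultraFamMul R), ← h', Category.assoc, ultraFamMul_right_unit,
      Category.comp_id]
  rw [h'']
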